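/- Let $2\le p<\infty$. There is a constant $C$, depending only on $p$, such that the following holds. Let $(\Omega,\mathcal A,\mathbb P)$ be a probability space, let $\{T_{i,j}\}_{(i,j)\in\mathbb Z^2}$ be an Abelian group of bimeasurable, measure-preserving bijections of $\Omega$ (with $T_{i,j}\circ T_{k,l}=T_{i+k,j+l}$), and let $\{\mathcal F_{i,j}\}_{(i,j)\in\mathbb Z^2}$ be a family of sub-$\sigma$-algebras of $\mathcal A$ such that - $\mathcal F_{i,j}\subset\mathcal F_{k,l}$ whenever $i\le k$ and $j\le l$; - $T_{i,j}^{-1}\mathcal F_{k,l}=\mathcal F_{k+i,l+j}$ for all $(i,j),(k,l)\in\mathbb Z^2$; - the filtration is commuting: $\mathbb E(Y\mid\mathcal F_{i,j})=\mathbb E(Y\mid\mathcal F_{i\wedge k,\,j\wedge l})$ almost surely for all $(i,j),(k,l)\in\mathbb Z^2$ and every bounded $\mathcal F_{k,l}$-measurable random variable $Y$. Put $\mathcal F_{\infty,\infty}=\bigvee_{(i,j)\in\mathbb Z^2}\mathcal F_{i,j}$, $\mathcal F_{i,\infty}=\bigvee_{j}\mathcal F_{i,j}$, $\mathcal F_{\infty,j}=\bigvee_i\mathcal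 F_{i,j}$, $\mathcal F_{-\infty,\infty}=\bigcap_{i\in\mathbb Z}\mathcal F_{i,\infty}$ and $\mathcal F_{\infty,-\infty}=\bigcap_{j\in\mathbb Z}\mathcal F_{\infty,j}$. Let $f\in L^p(\mathcal F_{\infty,\infty})$ be real-valued with $\mathbb E(f\mid\mathcal F_{-\infty,\infty})=\mathbb E(f\mid\mathcal F_{\infty,-\infty})=0$ almost surely, and write $S_{m,n}(f)=\sum_{i=1}^m\sum_{j=1}^n f\circ T_{i,j}$. (i) If $f$ is $\mathcal F_{0,0}$-measurable (up to modification on a null set), then for all $m,n\in\mathbb N$ $$\|S_{m,n}(f)\|_p\le C\,m^{1/2}n^{1/2}\sum_{k=1}^m\sum_{l=1}^n\frac{\|\mathbb E(S_{k,l}(f)\mid\mathcal F_{1,1})\|_p}{k^{3/2}\,l^{3/2}}.$$ (ii) If $\{f\circ T_{i,j}\}_{(i,j)\in\mathbb Z^2}$ are two-parameter martingale differences, in the sense that $f\in L^p(\mathcal F_{0,0})$ and $\mathbb E(f\mid\mathcal F_{0,-1})=\mathbb E(f\mid\mathcal F_{-1,0})=0$ almost surely, then for all $m,n\in\mathbb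 N$ $$\|S_{m,n}(f)\|_p\le C\,m^{1/2}n^{1/2}\,\|f\|_p.$$ -/

import Mathlib

open MeasureTheory
open scoped ENNReal NNReal

noncomputable section

namespace RandomField

variable {Ω : Type*} {mΩ : MeasurableSpace Ω}

/-- `T` is an (Abelian) group, indexed by `ℤ²`, of bimeasurable, measure-preserving bijections
of `Ω`: `T (i, j) = T_{i,j}` and `T_{k + l} = T_k ∘ T_l`. -/
structure IsMeasurePreservingGroup (μ : Measure Ω) (T : ℤ × ℤ → Ω ≃ᵐ Ω) : Prop where
  map_zero : ∀ ω, T 0 ω = ω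
  map_add : ∀ k l ω, T (k + l) ω = T k (T l ω)
  measurePreserving : ∀ k, MeasurePreserving (T k) μ μ

/-- The filtration is shifted by the group: `T_{-i,-j} 𝓕_{k,l} = T_{i,j}⁻¹ 𝓕_{k,l} = 𝓕_{k+i,l+j}`,
where `T_{i,j}⁻¹ 𝓕_{k,l}` consists of the preimages under `T_{i,j}` of the sets in `𝓕_{k,l}`. -/
def IsShifted (T : ℤ × ℤ → Ω ≃ᵐ Ω) (𝓕 : Filtration (ℤ × ℤ) mΩ) : Prop :=
  ∀ i j k l : ℤ, MeasurableSpace.comap (T (i, j)) (𝓕 (k, l)) = 𝓕 (k + i, l + j)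

/-- The 2-parameter filtration is commuting: for every bounded `𝓕_{k,l}`-measurable `Y`,
`E(Y | 𝓕_{i,j}) = E(Y | 𝓕_{i ∧ k, j ∧ l})` almost surely. -/
def IsCommuting (μ : Measure Ω) (𝓕 : Filtration (ℤ × ℤ) mΩ) : Prop :=
  ∀ (i j k l : ℤ) (Y : Ω → ℝ), Measurable[𝓕 (k, l)] Y → (∃ B : ℝ, ∀ ω, |Y ω| ≤ B) →
    μ[Y | 𝓕 (i, j)] =ᵐ[μ] μ[Y | 𝓕 (min i k, min j l)]

/-- `𝓕_{∞,∞}`. -/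
abbrev sigmaTop (𝓕 : Filtration (ℤ × ℤ) mΩ) : MeasurableSpace Ω := ⨆ k : ℤ × ℤ, 𝓕 k

/-- The marginal filtration `𝓕_{i,∞}`. -/
abbrev marginalFst (𝓕 : Filtration (ℤ × ℤ) mΩ) (i : ℤ) : MeasurableSpace Ω := ⨆ j : ℤ, 𝓕 (i, j)

/-- The marginal filtration `𝓕_{∞,j}`. -/
abbrev marginalSnd (𝓕 : Filtration (ℤ × ℤ) mΩ) (j : ℤ) : MeasurableSpace Ω := ⨆ i : ℤ, 𝓕 (i, j)

/-- `𝓕_{-∞,∞}`. -/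
abbrev tailFst (𝓕 : Filtration (ℤ × ℤ) mΩ) : MeasurableSpace Ω := ⨅ i : ℤ, marginalFst 𝓕 i

/-- `𝓕_{∞,-∞}`. -/
abbrev tailSnd (𝓕 : Filtration (ℤ × ℤ) mΩ) : MeasurableSpace Ω := ⨅ j : ℤ, marginalSnd 𝓕 j

/-- `f ∈ L^p(m)` for a sub-σ-algebra `m`: `f` is `p`-integrable and, up to modification on a null
set, `m`-measurable. -/
def MemLpSub (μ : Measure Ω) (m : MeasurableSpace Ω) (f : Ω → ℝ) (p : ℝ≥0∞) : Prop :=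
  AEStronglyMeasurable[m] f μ ∧ MemLp f p μ

/-- `S_{m,n}(f) = ∑_{i=1}^m ∑_{j=1}^n f ∘ T_{i,j}`. -/
def partialSum (T : ℤ × ℤ → Ω ≃ᵐ Ω) (f : Ω → ℝ) (m n : ℕ) : Ω → ℝ := fun ω =>
  ∑ i ∈ Finset.Icc 1 m, ∑ j ∈ Finset.Icc 1 n, f (T ((i : ℤ), (j : ℤ)) ω)

/-- The `f ∘ T_{i,j}` are two-parameter martingale differences in `L^p`:
`f ∈ L^p(𝓕_{0,0})` and `E(f | 𝓕_{0,-1}) = E(f | 𝓕_{-1,0}) = 0` almost surely. -/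
structure IsMartingaleDifference (μ : Measure Ω) (𝓕 : Filtration (ℤ × ℤ) mΩ) (f : Ω → ℝ)
    (p : ℝ≥0∞) : Prop where
  memLp : MemLpSub μ (𝓕 (0, 0)) f p
  condExp_fst : μ[f | 𝓕 (0, -1)] =ᵐ[μ] 0
  condExp_snd : μ[f | 𝓕 (-1, 0)] =ᵐ[μ] 0

end RandomField

end

/-! Both bounds come from a one-parameter inequality used once in each coordinate direction,
commutation making the two uses compatible.

For martingale differences, `eLpNorm_sum_martingaleDiff_le` gives the rate `√n`. In a second-order
expansion of `|S + d| ^ q` the linear term has mean zero, and the remaining error is at most the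
increment of `(K √n D) ^ q`, so an induction on `n` closes. For a general adapted sequence,
`eLpNorm_sum_le_dyadic` pairs neighbours: a pair minus its conditional expectation is a martingale
difference, and the conditional expectations form an adapted sequence of half the length. Iterating
gives a sum over powers of 2 of norms `‖E(S_k | 𝓖 0)‖`. Under stationarity these norms are
subadditive in `k`, so `sum_dyadic_le` replaces that sum by the one with weights `k ^ (-3/2)`.

For a rectangle, sum each column first and apply the one-parameter inequality to the columns. By
commutation (`condExp_partialSum_eq`), the conditional expectation that appears is again a
stationary adapted sum, now in the other direction, so the inequality applies a second time. For
martingale differences, commutation shows instead that the column sums are themselves martingale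
differences. -/

namespace RandomField

/-! ### Pointwise inequalities for `|·| ^ q` -/

/-- The sign-preserving power `x ↦ |x| ^ (q - 2) * x` grows at most like its derivative. -/
lemma signedPow_sub_mul_le_aux {s x y : ℝ} (hs : 0 ≤ s) (hxy : |y| ≤ |x|) :
    (|x| ^ s * x - |y| ^ s * y) * (x - y) ≤ (s + 2) * |x| ^ s * (x - y) ^ 2 := by
  rcases eq_or_ne x 0 with rfl | hx
  · have : y = 0 := by simpa using hxy
    subst this; simp
  have hx0 : 0 < |x| := abs_pos.2 hx
  have hX : 0 < |x| ^ s := Real.rpow_pos_of_pos hx0 s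
  have hY : 0 ≤ |y| ^ s := Real.rpow_nonneg (abs_nonneg y) s
  have hYX : |y| ^ s ≤ |x| ^ s := Real.rpow_le_rpow (abs_nonneg y) hxy hs
  -- The difference of powers is `|x|^s (x - y) + (|x|^s - |y|^s) y`. The second term costs `s + 1`,
  -- whence `s + 2`. By homogeneity only the ratio `u = |y| / |x|` matters, and Bernoulli settles `s
  -- ≥ 1`.
  have key : (|x| ^ s - |y| ^ s) * |y| ≤ (s + 1) * |x| ^ s * (|x| - |y|) := by
    set u := |y| / |x| with hu
    have hu0 : 0 ≤ u := by positivity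
    have hu1 : u ≤ 1 := (div_le_one hx0).2 hxy
    have hy : |y| = u * |x| := by rw [hu]; field_simp
    have h1 : (1 - u ^ s) * u ≤ (s + 1) * (1 - u) := by
      rcases le_total s 1 with h | h
      · have : u ≤ u ^ s := by
          rcases hu0.eq_or_lt with h0 | h0
          · rw [← h0]; exact Real.rpow_nonneg le_rfl _
          · simpa using Real.rpow_le_rpow_of_exponent_ge h0 hu1 h
        nlinarith [mul_nonneg hs (sub_nonneg.2 hu1), mul_nonneg (sub_nonneg.2 hu1) (sub_nonneg.2 hu1)]
      · have := one_add_mul_self_le_rpow_one_add (s := u - 1) (by linarith) h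
        have h2 : 1 - u ^ s ≤ s * (1 - u) := by
          rw [show (1 : ℝ) + (u - 1) = u by ring] at this; linarith
        have h3 : u ^ s ≤ 1 := Real.rpow_le_one hu0 hu1 hs
        nlinarith [mul_nonneg (sub_nonneg.2 h3) (sub_nonneg.2 hu1)]
    have h2 : |y| ^ s = u ^ s * |x| ^ s := by rw [hy, Real.mul_rpow hu0 hx0.le]
    rw [h2, hy]
    calc _ = (|x| ^ s * |x|) * ((1 - u ^ s) * u) := by ring
      _ ≤ (|x| ^ s * |x|) * ((s + 1) * (1 - u)) := by gcongr
      _ = _ := by ring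
  have h3 : |x| - |y| ≤ |x - y| := abs_sub_abs_le_abs_sub x y
  have h4 : (|x| ^ s - |y| ^ s) * (y * (x - y)) ≤ (s + 1) * |x| ^ s * (x - y) ^ 2 := by
    calc _ ≤ (|x| ^ s - |y| ^ s) * (|y| * |x - y|) := by
          rw [← abs_mul]
          exact mul_le_mul_of_nonneg_left (le_abs_self _) (by linarith)
      _ = ((|x| ^ s - |y| ^ s) * |y|) * |x - y| := by ring
      _ ≤ ((s + 1) * |x| ^ s * |x - y|) * |x - y| := by
          refine mul_le_mul_of_nonneg_right (key.trans ?_) (abs_nonneg _)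
          gcongr
      _ = _ := by rw [mul_assoc, abs_mul_abs_self]; ring
  nlinarith

lemma signedPow_sub_mul_le {s : ℝ} (hs : 0 ≤ s) (x y : ℝ) :
    (|x| ^ s * x - |y| ^ s * y) * (x - y) ≤ (s + 2) * (|x| ^ s + |y| ^ s) * (x - y) ^ 2 := by
  have hX : 0 ≤ |x| ^ s := Real.rpow_nonneg (abs_nonneg x) s
  have hY : 0 ≤ |y| ^ s := Real.rpow_nonneg (abs_nonneg y) s
  rcases le_total |y| |x| with h | h
  · refine (signedPow_sub_mul_le_aux hs h).trans ?_
    gcongr; linarith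
  · have := signedPow_sub_mul_le_aux hs h
    calc _ = (|y| ^ s * y - |x| ^ s * x) * (y - x) := by ring
      _ ≤ _ := this
      _ = (s + 2) * |y| ^ s * (x - y) ^ 2 := by ring
      _ ≤ _ := by gcongr; linarith

lemma abs_rpow_split {q : ℝ} (hq : 2 ≤ q) (x : ℝ) : |x| ^ q = |x| ^ (q - 2) * x ^ 2 := by
  rw [← sq_abs x, ← Real.rpow_natCast |x| 2, ← Real.rpow_add_of_nonneg (abs_nonneg x)
    (by linarith) (by norm_num)]
  congr 1; push_cast; ring

lemma rpow_sub_two_mul_sq_le {q : ℝ} (hq : 2 ≤ q) {u v : ℝ} (hu : 0 ≤ u) (hv : 0 ≤ v) :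
    u ^ (q - 2) * v ^ 2 ≤ u ^ q + v ^ q := by
  have h1 := abs_rpow_split hq u
  have h2 := abs_rpow_split hq v
  rw [abs_of_nonneg hu] at h1
  rw [abs_of_nonneg hv] at h2
  have hq2 : 0 ≤ q - 2 := by linarith
  rcases le_total u v with h | h
  · have : u ^ (q - 2) * v ^ 2 ≤ v ^ (q - 2) * v ^ 2 := by gcongr
    have := Real.rpow_nonneg hu q
    linarith
  · have : u ^ (q - 2) * v ^ 2 ≤ u ^ (q - 2) * u ^ 2 := by gcongr
    have := Real.rpow_nonneg hv q
    linarith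

/-- Convexity of `|·| ^ q`, in the form of the tangent inequality at `x`. -/
lemma abs_rpow_tangent {q : ℝ} (hq : 2 ≤ q) (x y : ℝ) :
    |x| ^ q + q * (|x| ^ (q - 2) * x) * (y - x) ≤ |y| ^ q := by
  have hq0 : 0 < q := by linarith
  have h1 := abs_rpow_split hq x
  have hc : (q / (q - 1)).HolderConjugate q :=
    (Real.HolderConjugate.conjExponent (by linarith : 1 < q)).symm
  have hY := Real.young_inequality_of_nonneg (a := |x| ^ (q - 1)) (b := |y|)
    (Real.rpow_nonneg (abs_nonneg x) _) (abs_nonneg y) hc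
  rw [← Real.rpow_mul (abs_nonneg x), show (q - 1) * (q / (q - 1)) = q by
    field_simp [(by linarith : q - 1 ≠ 0)]] at hY
  have h2 : |x| ^ (q - 2) * x * y ≤ |x| ^ (q - 1) * |y| := by
    have h : |x| ^ (q - 1) = |x| ^ (q - 2) * |x| := by
      rw [← Real.rpow_add_one' (abs_nonneg x) (by linarith)]; congr 1; ring
    rw [h, mul_assoc, mul_assoc, ← abs_mul]
    exact mul_le_mul_of_nonneg_left (le_abs_self _) (Real.rpow_nonneg (abs_nonneg x) _)
  have h3 : q * (|x| ^ q / (q / (q - 1)) + |y| ^ q / q) = (q - 1) * |x| ^ q + |y| ^ q := by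
    field_simp
  have h4 := mul_le_mul_of_nonneg_left (h2.trans hY) hq0.le
  rw [h3] at h4
  nlinarith

/-- A second-order Taylor bound for `|·| ^ q`. -/
lemma abs_add_rpow_le {q : ℝ} (hq : 2 ≤ q) : ∃ C : ℝ, 0 ≤ C ∧ ∀ a b : ℝ,
    |a + b| ^ q ≤ |a| ^ q + q * (|a| ^ (q - 2) * a * b) +
      C * (|a| ^ (q - 2) * b ^ 2 + |b| ^ q) := by
  refine ⟨q * (q * (2 ^ (q - 2) + 1)), by positivity, fun a b => ?_⟩
  have hq2 : 0 ≤ q - 2 := by linarith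
  -- The tangent is taken at `a + b`, so that convexity bounds `|a + b|^q` from above. Moving the
  -- slope back to `a` costs a difference of signed powers times `b`, bounded with `s = q - 2`.
  have h1 := abs_rpow_tangent hq (a + b) a
  have h2 := signedPow_sub_mul_le hq2 (a + b) a
  have hA : 0 ≤ |a| ^ (q - 2) := Real.rpow_nonneg (abs_nonneg a) _
  have hB : 0 ≤ |b| ^ (q - 2) := Real.rpow_nonneg (abs_nonneg b) _
  have h3 : |a + b| ^ (q - 2) ≤ 2 ^ (q - 2) * (|a| ^ (q - 2) + |b| ^ (q - 2)) := by
    have hm : |a + b| ≤ 2 * max |a| |b| :=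
      (abs_add_le a b).trans (by linarith [le_max_left |a| |b|, le_max_right |a| |b|])
    calc |a + b| ^ (q - 2) ≤ (2 * max |a| |b|) ^ (q - 2) := by gcongr
      _ = 2 ^ (q - 2) * (max |a| |b|) ^ (q - 2) := Real.mul_rpow (by norm_num) (by positivity)
      _ ≤ _ := by
        gcongr
        rcases max_choice |a| |b| with h | h <;> rw [h] <;> linarith
  rw [abs_rpow_split hq b]
  have h4 : q * (|a + b| ^ (q - 2) + |a| ^ (q - 2)) ≤
      q * (2 ^ (q - 2) + 1) * (|a| ^ (q - 2) + |b| ^ (q - 2)) := by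
    rw [mul_assoc]; gcongr; nlinarith
  have h5 : (|a + b| ^ (q - 2) * (a + b) - |a| ^ (q - 2) * a) * b ≤
      q * (2 ^ (q - 2) + 1) * (|a| ^ (q - 2) + |b| ^ (q - 2)) * b ^ 2 := by
    calc _ = (|a + b| ^ (q - 2) * (a + b) - |a| ^ (q - 2) * a) * (a + b - a) := by ring
      _ ≤ _ := h2
      _ = q * (|a + b| ^ (q - 2) + |a| ^ (q - 2)) * b ^ 2 := by ring
      _ ≤ _ := by gcongr
  have h6 := mul_le_mul_of_nonneg_left h5 (by linarith : 0 ≤ q)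
  nlinarith

/-! ### Moments of martingale difference sums -/

lemma integrable_abs_rpow {Ω : Type*} {mΩ : MeasurableSpace Ω} {μ : Measure Ω}
    [IsFiniteMeasure μ] {f : Ω → ℝ} {p : ℝ≥0∞} (hp : 2 ≤ p) (hp_top : p ≠ ∞)
    (hf : MemLp f p μ) : Integrable (fun ω => |f ω| ^ p.toReal) μ := by
  have := hf.integrable_norm_rpow (by rintro rfl; simp at hp) hp_top
  simpa using this

/-- One step of the martingale induction. In the integrated Taylor bound the linear term vanishes
because `|X|^(q-2) X` is `m`-measurable and `E(d | m) = 0`. -/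
lemma integral_abs_add_rpow_le {q : ℝ} (hq : 2 ≤ q) : ∃ C : ℝ, 0 ≤ C ∧
    ∀ {Ω : Type*} {m mΩ : MeasurableSpace Ω} {μ : Measure Ω} [IsProbabilityMeasure μ]
      (_ : m ≤ mΩ) {X d : Ω → ℝ} (_ : AEStronglyMeasurable[m] X μ)
      (_ : AEStronglyMeasurable d μ)
      (_ : Integrable (fun ω => |X ω| ^ q) μ) (_ : Integrable (fun ω => |d ω| ^ q) μ)
      (_ : Integrable d μ) (_ : μ[d | m] =ᵐ[μ] 0) {A D : ℝ} (_ : 0 < A) (_ : 0 < D)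
      (_ : ∫ ω, |X ω| ^ q ∂μ ≤ A ^ q) (_ : ∫ ω, |d ω| ^ q ∂μ ≤ D ^ q),
      ∫ ω, |X ω + d ω| ^ q ∂μ ≤ A ^ q + C * (2 * A ^ (q - 2) * D ^ 2 + D ^ q) := by
  obtain ⟨C, hC, hT⟩ := abs_add_rpow_le hq
  refine ⟨C, hC, ?_⟩
  intro Ω m mΩ μ _ hm X d hX hdm hXi hdi hd hcond A D hA hD hXA hdD
  have hq2 : 0 ≤ q - 2 := by linarith
  have hψm : AEStronglyMeasurable[m] (fun ω => |X ω| ^ (q - 2) * X ω) μ := by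
    have hc : Continuous fun x : ℝ => |x| ^ (q - 2) * x :=
      (continuous_abs.rpow_const fun _ => Or.inr hq2).mul continuous_id
    exact hc.comp_aestronglyMeasurable hX
  have hcross : Integrable (fun ω => (|X ω| ^ (q - 2) * X ω) * d ω) μ := by
    refine (hXi.add hdi).mono' ((hψm.mono hm).mul hdm) (Filter.Eventually.of_forall fun ω => ?_)
    have h1 := abs_rpow_split hq (X ω)
    have h2 := rpow_sub_two_mul_sq_le hq (abs_nonneg (X ω)) (abs_nonneg (d ω))
    have h3 := abs_rpow_split hq (d ω)
    have hP : 0 ≤ |X ω| ^ (q - 2) := Real.rpow_nonneg (abs_nonneg _) _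
    rw [Real.norm_eq_abs, abs_mul, abs_mul, abs_of_nonneg hP]
    simp only [Pi.add_apply]
    rcases le_total |X ω| |d ω| with h | h
    · have h4 : |X ω| ^ (q - 2) ≤ |d ω| ^ (q - 2) := by gcongr
      calc |X ω| ^ (q - 2) * |X ω| * |d ω| ≤ |d ω| ^ (q - 2) * |d ω| * |d ω| := by gcongr
        _ = |d ω| ^ q := by rw [h3, mul_assoc, abs_mul_abs_self, sq]
        _ ≤ _ := by linarith [Real.rpow_nonneg (abs_nonneg (X ω)) q]
    · calc |X ω| ^ (q - 2) * |X ω| * |d ω| ≤ |X ω| ^ (q - 2) * |X ω| * |X ω| := by gcongr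
        _ = |X ω| ^ q := by rw [h1, mul_assoc, abs_mul_abs_self, sq]
        _ ≤ _ := by linarith [Real.rpow_nonneg (abs_nonneg (d ω)) q]
  have hzero : ∫ ω, (|X ω| ^ (q - 2) * X ω) * d ω ∂μ = 0 := by
    have h := condExp_mul_of_aestronglyMeasurable_left hψm hcross hd
    rw [← integral_condExp hm]
    refine integral_eq_zero_of_ae (h.trans ?_)
    filter_upwards [hcond] with ω hω
    simp [hω]
  have hpt : ∀ ω, |X ω + d ω| ^ q ≤ |X ω| ^ q + q * ((|X ω| ^ (q - 2) * X ω) * d ω) +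
      C * ((A ^ (q - 2) * D ^ 2) * ((A ^ q)⁻¹ * |X ω| ^ q + (D ^ q)⁻¹ * |d ω| ^ q) +
        |d ω| ^ q) := by
    intro ω
    refine (hT (X ω) (d ω)).trans ?_
    have hA' : 0 < A ^ (q - 2) := Real.rpow_pos_of_pos hA _
    -- Normalising by `A` and `D` lets this pointwise bound replace Hölder's inequality. Each
    -- normalised moment is at most 1, which produces the factor 2.
    have := rpow_sub_two_mul_sq_le hq (u := |X ω| / A) (v := |d ω| / D)
      (by positivity) (by positivity)
    rw [Real.div_rpow (abs_nonneg _) hA.le, Real.div_rpow (abs_nonneg _) hA.le,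
      Real.div_rpow (abs_nonneg _) hD.le, div_pow, sq_abs] at this
    have hX2 : |X ω| ^ (q - 2) * d ω ^ 2 ≤
        (A ^ (q - 2) * D ^ 2) * ((A ^ q)⁻¹ * |X ω| ^ q + (D ^ q)⁻¹ * |d ω| ^ q) := by
      calc |X ω| ^ (q - 2) * d ω ^ 2
          = (A ^ (q - 2) * D ^ 2) * (|X ω| ^ (q - 2) / A ^ (q - 2) * (d ω ^ 2 / D ^ 2)) := by
            field_simp
        _ ≤ (A ^ (q - 2) * D ^ 2) * (|X ω| ^ q / A ^ q + |d ω| ^ q / D ^ q) := by gcongr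
        _ = _ := by ring
    gcongr
  have hI0 : Integrable (fun ω => (A ^ q)⁻¹ * |X ω| ^ q + (D ^ q)⁻¹ * |d ω| ^ q) μ :=
    (hXi.const_mul _).add (hdi.const_mul _)
  have hI2 : Integrable (fun ω => (A ^ (q - 2) * D ^ 2) *
      ((A ^ q)⁻¹ * |X ω| ^ q + (D ^ q)⁻¹ * |d ω| ^ q) + |d ω| ^ q) μ :=
    (hI0.const_mul _).add hdi
  have hI1 : Integrable (fun ω => |X ω| ^ q + q * ((|X ω| ^ (q - 2) * X ω) * d ω)) μ :=
    hXi.add (hcross.const_mul q)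
  refine (integral_mono_of_nonneg (Filter.Eventually.of_forall fun ω => by positivity)
    (hI1.add (hI2.const_mul C)) (Filter.Eventually.of_forall hpt)).trans ?_
  have hA' : 0 < A ^ q := Real.rpow_pos_of_pos hA _
  have hD' : 0 < D ^ q := Real.rpow_pos_of_pos hD _
  have e : ∫ ω, (|X ω| ^ q + q * ((|X ω| ^ (q - 2) * X ω) * d ω) +
      C * ((A ^ (q - 2) * D ^ 2) * ((A ^ q)⁻¹ * |X ω| ^ q + (D ^ q)⁻¹ * |d ω| ^ q) +
        |d ω| ^ q)) ∂μ = ∫ ω, |X ω| ^ q ∂μ + C * ((A ^ (q - 2) * D ^ 2) *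
        ((A ^ q)⁻¹ * ∫ ω, |X ω| ^ q ∂μ + (D ^ q)⁻¹ * ∫ ω, |d ω| ^ q ∂μ) +
        ∫ ω, |d ω| ^ q ∂μ) := by
    rw [integral_add hI1 (hI2.const_mul C),
      integral_add hXi (hcross.const_mul q), integral_const_mul, hzero, integral_const_mul,
      integral_add (hI0.const_mul _) hdi,
      integral_const_mul, integral_add (hXi.const_mul _) (hdi.const_mul _),
      integral_const_mul, integral_const_mul]
    ring
  have h1 : (A ^ q)⁻¹ * ∫ ω, |X ω| ^ q ∂μ ≤ 1 := (inv_mul_le_one₀ hA').2 hXA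
  have h2 : (D ^ q)⁻¹ * ∫ ω, |d ω| ^ q ∂μ ≤ 1 := (inv_mul_le_one₀ hD').2 hdD
  have h3 : (A ^ (q - 2) * D ^ 2) *
      ((A ^ q)⁻¹ * ∫ ω, |X ω| ^ q ∂μ + (D ^ q)⁻¹ * ∫ ω, |d ω| ^ q ∂μ) ≤
      2 * A ^ (q - 2) * D ^ 2 := by
    have := mul_le_mul_of_nonneg_left (add_le_add h1 h2)
      (by positivity : 0 ≤ A ^ (q - 2) * D ^ 2)
    linarith
  exact e.le.trans (by gcongr)

lemma eLpNorm_le_ofReal_iff {Ω : Type*} {mΩ : MeasurableSpace Ω} {μ : Measure Ω} {f : Ω → ℝ}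
    {p : ℝ≥0∞} (hp : 2 ≤ p) (hp_top : p ≠ ∞) (hf : MemLp f p μ) {A : ℝ} (hA : 0 ≤ A) :
    eLpNorm f p μ ≤ ENNReal.ofReal A ↔ ∫ ω, |f ω| ^ p.toReal ∂μ ≤ A ^ p.toReal := by
  have hp0 : p ≠ 0 := by rintro rfl; simp at hp
  have hq : 0 < p.toReal := ENNReal.toReal_pos hp0 hp_top
  rw [hf.eLpNorm_eq_integral_rpow_norm hp0 hp_top, ENNReal.ofReal_le_ofReal_iff hA]
  simp only [Real.norm_eq_abs]
  exact Real.rpow_inv_le_iff_of_pos (integral_nonneg fun ω => by positivity) hA hq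

lemma aestronglyMeasurable_finsetSum {Ω ι : Type*} {m mΩ : MeasurableSpace Ω} {μ : Measure Ω}
    {s : Finset ι} {f : ι → Ω → ℝ} (hf : ∀ i ∈ s, AEStronglyMeasurable[m] (f i) μ) :
    AEStronglyMeasurable[m] (∑ i ∈ s, f i) μ := by
  classical
  induction s using Finset.induction_on with
  | empty => simpa using stronglyMeasurable_zero.aestronglyMeasurable
  | insert a s ha ih =>
    rw [Finset.sum_insert ha]
    exact (hf a (Finset.mem_insert_self a s)).add
      (ih fun i hi => hf i (Finset.mem_insert_of_mem hi))

/-- Bernoulli's inequality at `1 / k`. With `s = q / 2` it bounds from below the growth of `√k ^ q`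
that has to absorb the error of one step. -/
lemma add_one_rpow_ge {s : ℝ} (hs : 1 ≤ s) {k : ℝ} (hk : 1 ≤ k) :
    k ^ s + k ^ (s - 1) ≤ (k + 1) ^ s := by
  have hk0 : 0 < k := by linarith
  have h := one_add_mul_self_le_rpow_one_add (s := 1 / k) (by linarith [one_div_pos.2 hk0]) hs
  have h1 : k + 1 = k * (1 + 1 / k) := by field_simp
  have hks : 0 < k ^ s := Real.rpow_pos_of_pos hk0 s
  have hk1 : k ^ (s - 1) = k ^ s * (1 / k) := by rw [Real.rpow_sub_one hk0.ne']; ring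
  rw [h1, Real.mul_rpow hk0.le (by positivity), hk1]
  calc k ^ s + k ^ s * (1 / k) = k ^ s * (1 + 1 * (1 / k)) := by ring
    _ ≤ k ^ s * (1 + s * (1 / k)) := by gcongr
    _ ≤ _ := by gcongr

/-- The step from `k` to `k + 1` adds at most `3 C K^(q-2) k^(q/2-1) E^q`. Once `3 C ≤ K²`, this is
below the increment of `(K √k E)^q`. -/
lemma eLpNorm_sum_martingaleDiff_le {p : ℝ≥0∞} (hp : 2 ≤ p) (hp_top : p ≠ ∞) :
    ∃ K : ℝ≥0, ∀ {Ω : Type*} {mΩ : MeasurableSpace Ω} {μ : Measure Ω} [IsProbabilityMeasure μ]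
      (𝓖 : Filtration ℕ mΩ) (d : ℕ → Ω → ℝ) (_ : ∀ i, AEStronglyMeasurable[𝓖 (i + 1)] (d i) μ)
      (_ : ∀ i, μ[d i | 𝓖 i] =ᵐ[μ] 0) (D : ℝ≥0) (_ : ∀ i, eLpNorm (d i) p μ ≤ D) (n : ℕ),
      eLpNorm (∑ i ∈ Finset.range n, d i) p μ ≤ ((K * NNReal.sqrt n * D : ℝ≥0) : ℝ≥0∞) := by
  set q := p.toReal
  have hq : 2 ≤ q := by simpa using (ENNReal.toReal_le_toReal (by simp) hp_top).2 hp
  obtain ⟨C, hC, hstep⟩ := integral_abs_add_rpow_le hq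
  obtain ⟨K, hK1, hKC⟩ : ∃ K : ℝ, 1 ≤ K ∧ 3 * C ≤ K ^ 2 :=
    ⟨3 * C + 1, by linarith, by nlinarith⟩
  have hK0 : 0 < K := by linarith
  refine ⟨K.toNNReal, ?_⟩
  intro Ω mΩ μ _ 𝓖 d hdm hcond D hD n
  have hp1 : 1 ≤ p := le_trans (by norm_num) hp
  have hdL : ∀ i, MemLp (d i) p μ := fun i =>
    ⟨(hdm i).mono (𝓖.le _), (hD i).trans_lt ENNReal.coe_lt_top⟩
  have hML : ∀ n, MemLp (∑ i ∈ Finset.range n, d i) p μ := fun n =>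
    memLp_finsetSum' _ fun i _ => hdL i
  -- The one-step bound divides by its two scales, so `D` is replaced by any larger, hence positive,
  -- `E`; the slack is removed at the end. For the same reason `k = 0` is treated apart.
  have main : ∀ E : ℝ, D < E → ∀ n : ℕ,
      ∫ ω, |(∑ i ∈ Finset.range n, d i) ω| ^ q ∂μ ≤ (K * √n * E) ^ q := by
    intro E hE n
    have hE0 : 0 < E := lt_of_le_of_lt D.2 hE
    have hdE : ∀ i, ∫ ω, |d i ω| ^ q ∂μ ≤ E ^ q := fun i =>
      (eLpNorm_le_ofReal_iff hp hp_top (hdL i) hE0.le).1 <| (hD i).trans <| by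
        rw [← ENNReal.ofReal_coe_nnreal]; exact ENNReal.ofReal_le_ofReal hE.le
    induction n with
    | zero => simp [Real.zero_rpow (by linarith : q ≠ 0)]
    | succ k ih =>
      rcases Nat.eq_zero_or_pos k with rfl | hk
      · simp only [zero_add, Finset.sum_range_one, Nat.cast_one, Real.sqrt_one, mul_one]
        refine (hdE 0).trans ?_
        gcongr
        nlinarith
      have hk1 : (1 : ℝ) ≤ k := by exact_mod_cast hk
      have hk0 : (0 : ℝ) < k := by linarith
      have hsum : AEStronglyMeasurable[𝓖 k] (∑ i ∈ Finset.range k, d i) μ :=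
        aestronglyMeasurable_finsetSum fun i hi =>
          (hdm i).mono (𝓖.mono (by simpa using hi))
      have h := hstep (𝓖.le k) hsum (hdL k).1 (integrable_abs_rpow hp hp_top (hML k))
        (integrable_abs_rpow hp hp_top (hdL k)) ((hdL k).integrable hp1) (hcond k)
        (by positivity : 0 < K * √k * E) hE0 ih (hdE k)
      simp only [Finset.sum_range_succ, Pi.add_apply]
      refine h.trans ?_
      have hsq : ∀ (x r : ℝ), 0 ≤ x → √x ^ r = x ^ (r / 2) := fun x r hx => by
        rw [Real.sqrt_eq_rpow, ← Real.rpow_mul hx]; congr 1; ring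
      have hc : ((k + 1 : ℕ) : ℝ) = k + 1 := by push_cast; ring
      have hg := add_one_rpow_ge (by linarith : 1 ≤ q / 2) hk1
      rw [hc, Real.mul_rpow (by positivity) hE0.le, Real.mul_rpow (by positivity) hE0.le,
        Real.mul_rpow (by positivity) hE0.le, Real.mul_rpow hK0.le (by positivity),
        Real.mul_rpow hK0.le (by positivity), Real.mul_rpow hK0.le (by positivity),
        hsq _ _ hk0.le, hsq _ _ hk0.le, hsq _ _ (by linarith),
        show (q - 2) / 2 = q / 2 - 1 by ring]
      have hEq := abs_rpow_split hq E
      have hKq := abs_rpow_split hq K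
      rw [abs_of_pos hE0] at hEq
      rw [abs_of_pos hK0] at hKq
      have hEp : 0 < E ^ q := Real.rpow_pos_of_pos hE0 q
      have hKp : 1 ≤ K ^ (q - 2) := Real.one_le_rpow hK1 (by linarith)
      have hkp : 1 ≤ (k : ℝ) ^ (q / 2 - 1) := Real.one_le_rpow hk1 (by linarith)
      have hprod : 1 ≤ K ^ (q - 2) * (k : ℝ) ^ (q / 2 - 1) := one_le_mul_of_one_le_of_one_le hKp hkp
      calc K ^ q * (k : ℝ) ^ (q / 2) * E ^ q + C * (2 * (K ^ (q - 2) * (k : ℝ) ^ (q / 2 - 1) *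
              E ^ (q - 2)) * E ^ 2 + E ^ q)
          = (K ^ q * (k : ℝ) ^ (q / 2) +
              C * (2 * (K ^ (q - 2) * (k : ℝ) ^ (q / 2 - 1)) + 1)) * E ^ q := by
            rw [hEq]; ring
        _ ≤ (K ^ q * (k : ℝ) ^ (q / 2) +
              C * (3 * (K ^ (q - 2) * (k : ℝ) ^ (q / 2 - 1)))) * E ^ q := by
            gcongr; linarith
        _ = (K ^ q * (k : ℝ) ^ (q / 2) +
              (3 * C) * (K ^ (q - 2) * (k : ℝ) ^ (q / 2 - 1))) * E ^ q := by ring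
        _ ≤ (K ^ q * (k : ℝ) ^ (q / 2) +
              K ^ 2 * (K ^ (q - 2) * (k : ℝ) ^ (q / 2 - 1))) * E ^ q := by gcongr
        _ = K ^ q * ((k : ℝ) ^ (q / 2) + (k : ℝ) ^ (q / 2 - 1)) * E ^ q := by
            rw [hKq]; ring
        _ ≤ _ := by gcongr
  refine ENNReal.le_of_forall_pos_le_add fun ε hε _ => ?_
  have hden : 0 < K * √n + 1 := by positivity
  have hE := main (D + ε / (K * √n + 1)) (by have : (0 : ℝ) < ε := hε; simp; positivity) n
  have hE' := (eLpNorm_le_ofReal_iff hp hp_top (hML n) (by positivity)).2 hE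
  refine hE'.trans ?_
  rw [← ENNReal.coe_add, ← ENNReal.ofReal_coe_nnreal]
  refine ENNReal.ofReal_le_ofReal ?_
  have h1 : K * √n * (ε / (K * √n + 1)) ≤ ε := by
    rw [mul_div_assoc', div_le_iff₀ hden]
    have : (0 : ℝ) ≤ ε := ε.2
    nlinarith
  have h2 : ((K.toNNReal * NNReal.sqrt n * D + ε : ℝ≥0) : ℝ) = K * √n * D + ε := by
    push_cast; simp [hK0.le]
  rw [h2]
  linarith

/-! ### Dyadic decomposition of adapted sums -/

/-- The filtration observed at even times. -/
def evenFiltration {Ω : Type*} {mΩ : MeasurableSpace Ω} (𝓖 : Filtration ℕ mΩ) :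
    Filtration ℕ mΩ where
  seq i := 𝓖 (2 * i)
  mono' _ _ h := 𝓖.mono (Nat.mul_le_mul_left 2 h)
  le' i := 𝓖.le (2 * i)

lemma sum_Ico_pairs {M : Type*} [AddCommMonoid M] (X : ℕ → M) (s k : ℕ) :
    ∑ i ∈ Finset.Ico s (s + k), (X (2 * i) + X (2 * i + 1)) =
      ∑ i ∈ Finset.Ico (2 * s) (2 * s + 2 * k), X i := by
  induction k with
  | zero => simp
  | succ k ih =>
    rw [← add_assoc, Finset.sum_Ico_succ_top (by omega), ih,
      show 2 * s + 2 * (k + 1) = 2 * s + 2 * k + 1 + 1 by ring,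
      Finset.sum_Ico_succ_top (by omega), Finset.sum_Ico_succ_top (by omega),
      show 2 * (s + k) = 2 * s + 2 * k by ring, ← add_assoc]

/-- Induction on the dyadic level `r`. The conditioned pairs `X'` satisfy the hypotheses for the
even filtration with `k ↦ a (2 * k)`, and halving the length contributes the factor `1 / √2`. -/
lemma eLpNorm_sum_le_dyadic {p : ℝ≥0∞} (hp : 2 ≤ p) (hp_top : p ≠ ∞) :
    ∃ K : ℝ≥0, ∀ {Ω : Type*} {mΩ : MeasurableSpace Ω} {μ : Measure Ω} [IsProbabilityMeasure μ]
      (r : ℕ) (𝓖 : Filtration ℕ mΩ) (X : ℕ → Ω → ℝ) (_ : ∀ i, MemLp (X i) p μ)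
      (_ : ∀ i, AEStronglyMeasurable[𝓖 i] (X i) μ) (a : ℕ → ℝ≥0)
      (_ : ∀ s k, eLpNorm (μ[∑ i ∈ Finset.Ico s (s + k), X i | 𝓖 s]) p μ ≤ a k)
      (n : ℕ) (_ : 2 ^ r ≤ n) (_ : n < 2 ^ (r + 1)),
      eLpNorm (∑ i ∈ Finset.range n, X i) p μ ≤
        ((K * NNReal.sqrt n * ∑ j ∈ Finset.range (r + 1), a (2 ^ j) / NNReal.sqrt 2 ^ j : ℝ≥0) :
          ℝ≥0∞) := by
  have hp1 : 1 ≤ p := le_trans (by norm_num) hp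
  obtain ⟨K, hK⟩ := eLpNorm_sum_martingaleDiff_le hp hp_top
  -- `4 K` pays for the centred pairs, whose norms are at most `4 a 1`, and `1` for the unpaired
  -- last term when `n` is odd. Together they make up the `j = 0` summand.
  refine ⟨4 * K + 1, ?_⟩
  intro Ω mΩ μ _ r
  induction r with
  | zero =>
    intro 𝓖 X hX hXm a ha n hn hn'
    have hn1 : n = 1 := by simp at hn hn'; omega
    subst hn1
    have h := ha 0 1
    simp only [zero_add, Nat.Ico_zero_eq_range, Finset.sum_range_one] at h
    rw [eLpNorm_congr_ae (condExp_of_aestronglyMeasurable' (𝓖.le 0) (hXm 0)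
      ((hX 0).integrable hp1))] at h
    simp only [Finset.sum_range_one, zero_add, pow_zero, div_one, Nat.cast_one, NNReal.sqrt_one,
      mul_one]
    refine h.trans (ENNReal.coe_le_coe.2 ?_)
    exact le_mul_of_one_le_left zero_le (by simp)
  | succ r ih =>
    intro 𝓖 X hX hXm a ha n hn hn'
    have hXa : ∀ i, eLpNorm (X i) p μ ≤ a 1 := fun i => by
      have h := ha i 1
      rw [Nat.Ico_succ_singleton, Finset.sum_singleton] at h
      rwa [eLpNorm_congr_ae (condExp_of_aestronglyMeasurable' (𝓖.le i) (hXm i)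
        ((hX i).integrable hp1))] at h
    set Y : ℕ → Ω → ℝ := fun i => X (2 * i) + X (2 * i + 1) with hY
    set X' : ℕ → Ω → ℝ := fun i => μ[Y i | 𝓖 (2 * i)] with hX'
    have hYL : ∀ i, MemLp (Y i) p μ := fun i => (hX _).add (hX _)
    have hYi : ∀ i, Integrable (Y i) μ := fun i => (hYL i).integrable hp1
    have hX'L : ∀ i, MemLp (X' i) p μ := fun i => (hYL i).condExp hp1
    have hYn : ∀ i, eLpNorm (Y i) p μ ≤ 2 * a 1 := fun i =>
      (eLpNorm_add_le (hX _).1 (hX _).1 hp1).trans <| by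
        rw [two_mul (a 1 : ℝ≥0∞)]; exact add_le_add (hXa _) (hXa _)
    obtain ⟨h, b, hb, hnh⟩ : ∃ h b, b < 2 ∧ n = 2 * h + b :=
      ⟨n / 2, n % 2, Nat.mod_lt _ (by norm_num), (Nat.div_add_mod n 2).symm⟩
    have hh : 2 ^ r ≤ h ∧ h < 2 ^ (r + 1) := by
      constructor
      · have : 2 ^ (r + 1) = 2 * 2 ^ r := by ring
        omega
      · have : 2 ^ (r + 1 + 1) = 2 * 2 ^ (r + 1) := by ring
        omega
    have h1 := ih (evenFiltration 𝓖) X' hX'L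
      (fun i => stronglyMeasurable_condExp.aestronglyMeasurable) (fun k => a (2 * k)) (by
        intro s k
        have hle : ∀ i ∈ Finset.Ico s (s + k), 𝓖 (2 * s) ≤ 𝓖 (2 * i) := fun i hi =>
          𝓖.mono (by rw [Finset.mem_Ico] at hi; omega)
        -- By the tower property, conditioning removes the inner conditional expectations and leaves
        -- a block of `X` of twice the length.
        have e : μ[∑ i ∈ Finset.Ico s (s + k), X' i | 𝓖 (2 * s)] =ᵐ[μ]
            μ[∑ i ∈ Finset.Ico (2 * s) (2 * s + 2 * k), X i | 𝓖 (2 * s)] := by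
          rw [← sum_Ico_pairs]
          refine (condExp_finsetSum (fun i _ => integrable_condExp) _).trans
            (Filter.EventuallyEq.trans ?_ (condExp_finsetSum (fun i _ => hYi i) _).symm)
          exact eventuallyEq_sum fun i hi => condExp_condExp_of_le (hle i hi) (𝓖.le _)
        change eLpNorm (μ[∑ i ∈ Finset.Ico s (s + k), X' i | 𝓖 (2 * s)]) p μ ≤ _
        rw [eLpNorm_congr_ae e]
        exact ha _ _) h hh.1 hh.2
    have h2 := hK (evenFiltration 𝓖) (fun i => Y i - X' i) (fun i => by
        have hm : ∀ j ≤ 2 * (i + 1), AEStronglyMeasurable[𝓖 (2 * (i + 1))] (X j) μ :=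
          fun j hj => (hXm j).mono (𝓖.mono hj)
        exact ((hm _ (by omega)).add (hm _ (by omega))).sub
          ((stronglyMeasurable_condExp.mono (𝓖.mono (by omega))).aestronglyMeasurable))
      (fun i => by
        refine (condExp_sub (hYi i) integrable_condExp _).trans ?_
        have : μ[X' i | 𝓖 (2 * i)] =ᵐ[μ] X' i := condExp_condExp_of_le le_rfl (𝓖.le _)
        filter_upwards [this] with ω hω
        simp only [Pi.sub_apply, Pi.zero_apply]
        change X' i ω - (μ[X' i | 𝓖 (2 * i)]) ω = 0
        rw [hω, sub_self]) (4 * a 1)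
      (fun i => by
        refine (eLpNorm_sub_le (hYL i).1 (hX'L i).1 hp1).trans ?_
        refine (add_le_add (hYn i) ((eLpNorm_condExp_le_eLpNorm _ hp1).trans (hYn i))).trans ?_
        rw [← two_mul, ← mul_assoc]
        push_cast
        norm_num) h
    have hsplit : ∑ i ∈ Finset.range n, X i = (∑ i ∈ Finset.range h, (Y i - X' i) +
        ∑ i ∈ Finset.range h, X' i) + ∑ i ∈ Finset.range b, X (2 * h + i) := by
      rw [Finset.sum_sub_distrib, sub_add_cancel, hnh, Finset.sum_range_add]
      congr 1
      simpa using (sum_Ico_pairs X 0 h).symm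
    have h3 : eLpNorm (∑ i ∈ Finset.range b, X (2 * h + i)) p μ ≤ a 1 := by
      interval_cases b
      · simp
      · simpa using hXa (2 * h)
    have hm1 : MemLp (∑ i ∈ Finset.range h, (Y i - X' i)) p μ :=
      memLp_finsetSum' _ fun i _ => (hYL i).sub (hX'L i)
    have hm2 : MemLp (∑ i ∈ Finset.range h, X' i) p μ := memLp_finsetSum' _ fun i _ => hX'L i
    have hm3 : MemLp (∑ i ∈ Finset.range b, X (2 * h + i)) p μ :=
      memLp_finsetSum' _ fun i _ => hX _
    rw [hsplit]
    refine (eLpNorm_add_le (hm1.add hm2).1 hm3.1 hp1).trans ?_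
    refine (add_le_add ((eLpNorm_add_le hm1.1 hm2.1 hp1).trans (add_le_add h2 h1)) h3).trans ?_
    rw [← ENNReal.coe_add, ← ENNReal.coe_add, ENNReal.coe_le_coe]
    have hn1 : 1 ≤ NNReal.sqrt n := by
      rw [NNReal.one_le_sqrt]
      exact_mod_cast (Nat.one_le_two_pow).trans hn
    have hhn : NNReal.sqrt h ≤ NNReal.sqrt n / NNReal.sqrt 2 := by
      rw [← NNReal.sqrt_div]
      gcongr
      rw [le_div_iff₀ (by norm_num)]
      exact_mod_cast (by omega : h * 2 ≤ n)
    have hhn' : NNReal.sqrt h ≤ NNReal.sqrt n := by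
      gcongr
      omega
    rw [Finset.sum_range_succ' _ (r + 1)]
    simp only [pow_zero, div_one]
    have e : ∑ j ∈ Finset.range (r + 1), a (2 ^ (j + 1)) / NNReal.sqrt 2 ^ (j + 1) =
        (∑ j ∈ Finset.range (r + 1), a (2 * 2 ^ j) / NNReal.sqrt 2 ^ j) / NNReal.sqrt 2 := by
      rw [Finset.sum_div]
      refine Finset.sum_congr rfl fun j _ => ?_
      rw [pow_succ', pow_succ, div_div]
    rw [e]
    calc _ ≤ K * NNReal.sqrt n * (4 * a 1) + (4 * K + 1) * (NNReal.sqrt n / NNReal.sqrt 2) *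
          (∑ j ∈ Finset.range (r + 1), a (2 * 2 ^ j) / NNReal.sqrt 2 ^ j) +
            NNReal.sqrt n * a 1 := by
          gcongr
          exact le_mul_of_one_le_left zero_le hn1
      _ = _ := by ring

/-! ### Weighted sums of subadditive sequences -/

/-- Sum `a N ≤ a k + a (N - k)` over `1 ≤ k < N` and use `N ≤ 2 (N - 1)`. -/
lemma subadditive_mul_le_sum {a : ℕ → ℝ} (h0 : ∀ k, 0 ≤ a k)
    (hsub : ∀ k l, a (k + l) ≤ a k + a l) {N : ℕ} (hN : 2 ≤ N) :
    N * a N ≤ 4 * ∑ k ∈ Finset.Ico 1 N, a k := by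
  have h1 : ∑ k ∈ Finset.Ico 1 N, a (N - k) = ∑ k ∈ Finset.Ico 1 N, a k := by
    have := Finset.sum_Ico_reflect a 1 (Nat.le_succ N)
    simpa using this
  have h2 : ((N : ℝ) - 1) * a N ≤ ∑ k ∈ Finset.Ico 1 N, (a k + a (N - k)) := by
    calc ((N : ℝ) - 1) * a N = ∑ k ∈ Finset.Ico 1 N, a N := by
          rw [Finset.sum_const, Nat.card_Ico, nsmul_eq_mul, Nat.cast_sub (by omega)]; simp
      _ ≤ _ := Finset.sum_le_sum fun k hk => by
          rw [Finset.mem_Ico] at hk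
          have := hsub k (N - k)
          rwa [Nat.add_sub_cancel' hk.2.le] at this
  rw [Finset.sum_add_distrib, h1] at h2
  have h3 : (2 : ℝ) ≤ N := by exact_mod_cast hN
  nlinarith [h0 N]

/-- The second term on the left is a potential that carries the induction: the old potential pays
for the terms below `2 ^ r`, both in the new dyadic term and in the new potential. -/
lemma sum_dyadic_le_aux {a : ℕ → ℝ} (h0 : ∀ k, 0 ≤ a k)
    (hsub : ∀ k l, a (k + l) ≤ a k + a l) (r : ℕ) :
    ∑ j ∈ Finset.range (r + 1), a (2 ^ j) / √2 ^ j +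
        4 / (√2 ^ 3) ^ r * ∑ k ∈ Finset.Ico 1 (2 ^ r), a k ≤
      a 1 + 8 * ∑ k ∈ Finset.Ico 1 (2 ^ r), a k / (k : ℝ) ^ (3 / 2 : ℝ) := by
  have hs0 : 0 < √2 := by positivity
  have hs2 : √2 ^ 2 = 2 := Real.sq_sqrt (by norm_num)
  induction r with
  | zero => simp
  | succ r ih =>
    rw [Finset.sum_range_succ]
    have hle : 2 ^ r ≤ 2 ^ (r + 1) := Nat.pow_le_pow_right (by norm_num) (by omega)
    have hpow : ((2 ^ (r + 1) : ℕ) : ℝ) = (√2 ^ (r + 1)) ^ 2 := by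
      rw [← pow_mul, mul_comm, pow_mul, hs2]; push_cast; rfl
    have hcons := fun g : ℕ → ℝ => Finset.sum_Ico_consecutive g (Nat.one_le_two_pow (n := r)) hle
    have hN := subadditive_mul_le_sum h0 hsub (N := 2 ^ (r + 1))
      (by calc 2 = 2 ^ 1 := rfl
            _ ≤ 2 ^ (r + 1) := Nat.pow_le_pow_right (by norm_num) (by omega))
    rw [hpow] at hN
    rw [← hcons a] at hN ⊢
    rw [← hcons]
    set T := ∑ k ∈ Finset.Ico 1 (2 ^ r), a k
    set W := ∑ k ∈ Finset.Ico (2 ^ r) (2 ^ (r + 1)), a k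
    set w := √2 ^ (r + 1) with hw
    have hw0 : 0 < w := by positivity
    have hT : 0 ≤ T := Finset.sum_nonneg fun k _ => h0 k
    have hWle : W / w ^ 3 ≤
        ∑ k ∈ Finset.Ico (2 ^ r) (2 ^ (r + 1)), a k / (k : ℝ) ^ (3 / 2 : ℝ) := by
      rw [Finset.sum_div]
      refine Finset.sum_le_sum fun k hk => ?_
      rw [Finset.mem_Ico] at hk
      have hk0 : (0 : ℝ) < k := by exact_mod_cast (pow_pos (by norm_num : 0 < 2) r).trans_le hk.1
      have hkw : (k : ℝ) ≤ w ^ 2 := by rw [hw, ← hpow]; exact_mod_cast hk.2.le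
      refine div_le_div_of_nonneg_left (h0 k) (Real.rpow_pos_of_pos hk0 _) ?_
      calc (k : ℝ) ^ (3 / 2 : ℝ) ≤ (w ^ 2) ^ (3 / 2 : ℝ) := by gcongr
        _ = w ^ 3 := by
          rw [← Real.rpow_natCast w 2, ← Real.rpow_mul hw0.le, ← Real.rpow_natCast w 3]
          norm_num
    have hN' : a (2 ^ (r + 1)) / w ≤ 4 * (T + W) / w ^ 3 := by
      rw [div_le_div_iff₀ hw0 (by positivity)]
      nlinarith
    have e1 : (√2 ^ 3) ^ (r + 1) = w ^ 3 := by rw [hw]; ring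
    have e2 : 4 / (√2 ^ 3) ^ r * T = 4 * √2 ^ 3 * T / w ^ 3 := by
      rw [hw]; field_simp; ring
    have hs3 : 2 ≤ √2 ^ 3 := by
      have : 1 ≤ √2 := Real.one_le_sqrt.2 (by norm_num)
      nlinarith
    rw [e2] at ih
    rw [e1]
    -- The coefficients of `W` agree, and those of `T` compare by `8 ≤ 4 * √2 ^ 3`.
    have h5 : 4 * (T + W) / w ^ 3 + 4 / w ^ 3 * (T + W) ≤
        4 * √2 ^ 3 * T / w ^ 3 + 8 * (W / w ^ 3) := by
      rw [← sub_nonneg]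
      have : 4 * √2 ^ 3 * T / w ^ 3 + 8 * (W / w ^ 3) -
          (4 * (T + W) / w ^ 3 + 4 / w ^ 3 * (T + W)) = (4 * (√2 ^ 3 - 2) * T) / w ^ 3 := by
        field_simp; ring
      rw [this]
      have : 0 ≤ √2 ^ 3 - 2 := by linarith
      positivity
    linarith

/-- Dyadic sums of a subadditive sequence are controlled by its weighted sum. -/
lemma sum_dyadic_le {a : ℕ → ℝ≥0} (hsub : ∀ k l, a (k + l) ≤ a k + a l) {r n : ℕ}
    (hn : 2 ^ r ≤ n) :
    ∑ j ∈ Finset.range (r + 1), a (2 ^ j) / NNReal.sqrt 2 ^ j ≤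
      9 * ∑ k ∈ Finset.Icc 1 n, a k / (k : ℝ≥0) ^ (3 / 2 : ℝ) := by
  rw [← NNReal.coe_le_coe]
  push_cast
  have h := sum_dyadic_le_aux (a := fun k => (a k : ℝ)) (fun k => (a k).2)
    (fun k l => by exact_mod_cast hsub k l) r
  have hnn : ∀ k : ℕ, 0 ≤ (a k : ℝ) / (k : ℝ) ^ (3 / 2 : ℝ) := fun k => by positivity
  -- `a 1` is the `k = 1` summand, so `9 = 1 + 8`.
  have h1 : (a 1 : ℝ) ≤ ∑ k ∈ Finset.Icc 1 n, (a k : ℝ) / (k : ℝ) ^ (3 / 2 : ℝ) := by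
    have := Finset.single_le_sum (f := fun k : ℕ => (a k : ℝ) / (k : ℝ) ^ (3 / 2 : ℝ))
      (fun k _ => hnn k) (Finset.mem_Icc.2 ⟨le_rfl, (Nat.one_le_two_pow).trans hn⟩)
    simpa using this
  have h2 : ∑ k ∈ Finset.Ico 1 (2 ^ r), (a k : ℝ) / (k : ℝ) ^ (3 / 2 : ℝ) ≤
      ∑ k ∈ Finset.Icc 1 n, (a k : ℝ) / (k : ℝ) ^ (3 / 2 : ℝ) :=
    Finset.sum_le_sum_of_subset_of_nonneg (fun k hk => by
      rw [Finset.mem_Ico] at hk; rw [Finset.mem_Icc]; omega) fun k _ _ => hnn k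
  have h3 : 0 ≤ 4 / (√2 ^ 3) ^ r * ∑ k ∈ Finset.Ico 1 (2 ^ r), (a k : ℝ) := by positivity
  linarith

lemma eLpNorm_sum_le_of_stationary {p : ℝ≥0∞} (hp : 2 ≤ p) (hp_top : p ≠ ∞) :
    ∃ K : ℝ≥0, ∀ {Ω : Type*} {mΩ : MeasurableSpace Ω} {μ : Measure Ω} [IsProbabilityMeasure μ]
      (𝓖 : Filtration ℕ mΩ) (X : ℕ → Ω → ℝ) (_ : ∀ i, MemLp (X i) p μ)
      (_ : ∀ i, AEStronglyMeasurable[𝓖 i] (X i) μ)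
      (_ : ∀ s k, eLpNorm (μ[∑ i ∈ Finset.Ico s (s + k), X i | 𝓖 s]) p μ =
        eLpNorm (μ[∑ i ∈ Finset.range k, X i | 𝓖 0]) p μ) (n : ℕ),
      eLpNorm (∑ i ∈ Finset.range n, X i) p μ ≤
        K * (n : ℝ≥0∞) ^ (1 / 2 : ℝ) * ∑ k ∈ Finset.Icc 1 n,
          eLpNorm (μ[∑ i ∈ Finset.range k, X i | 𝓖 0]) p μ / (k : ℝ≥0∞) ^ (3 / 2 : ℝ) := by
  have hp1 : 1 ≤ p := le_trans (by norm_num) hp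
  obtain ⟨K, hK⟩ := eLpNorm_sum_le_dyadic hp hp_top
  refine ⟨9 * K, ?_⟩
  intro Ω mΩ μ _ 𝓖 X hX hXm hst n
  rcases Nat.eq_zero_or_pos n with rfl | hn
  · simp
  have hL : ∀ k s, MemLp (μ[∑ i ∈ Finset.range k, X i | 𝓖 s]) p μ := fun k s =>
    (memLp_finsetSum' _ fun i _ => hX i).condExp hp1
  set a : ℕ → ℝ≥0 := fun k => (eLpNorm (μ[∑ i ∈ Finset.range k, X i | 𝓖 0]) p μ).toNNReal
    with ha
  have hac : ∀ k, (a k : ℝ≥0∞) = eLpNorm (μ[∑ i ∈ Finset.range k, X i | 𝓖 0]) p μ := fun k =>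
    ENNReal.coe_toNNReal (hL k 0).2.ne
  -- Condition the second block on `𝓖 k` first: conditioning on `𝓖 0` is then a contraction, and
  -- stationarity identifies the norm as `a l`.
  have hsub : ∀ k l, a (k + l) ≤ a k + a l := fun k l => by
    rw [← ENNReal.coe_le_coe, ENNReal.coe_add, hac, hac, hac, ← hst k l]
    have hI : ∀ s : Finset ℕ, Integrable (∑ i ∈ s, X i) μ := fun s =>
      (memLp_finsetSum' _ fun i _ => hX i).integrable hp1
    have hIL : MemLp (∑ i ∈ Finset.Ico k (k + l), X i) p μ := memLp_finsetSum' _ fun i _ => hX i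
    have e : μ[∑ i ∈ Finset.range (k + l), X i | 𝓖 0] =ᵐ[μ]
        μ[∑ i ∈ Finset.range k, X i | 𝓖 0] +
          μ[μ[∑ i ∈ Finset.Ico k (k + l), X i | 𝓖 k] | 𝓖 0] := by
      rw [← Finset.sum_range_add_sum_Ico _ (Nat.le_add_right k l)]
      refine (condExp_add (hI _) (hI _) _).trans (Filter.EventuallyEq.rfl.add ?_)
      exact (condExp_condExp_of_le (𝓖.mono (Nat.zero_le k)) (𝓖.le k)).symm
    rw [eLpNorm_congr_ae e]
    refine (eLpNorm_add_le (hL k 0).1 ((hIL.condExp hp1).condExp hp1).1 hp1).trans ?_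
    exact add_le_add le_rfl (eLpNorm_condExp_le_eLpNorm _ hp1)
  set r := Nat.log 2 n
  have hr : 2 ^ r ≤ n := Nat.pow_log_le_self 2 hn.ne'
  have h1 := hK r 𝓖 X hX hXm a (fun s k => by rw [hac, hst]) n hr
    (Nat.lt_pow_succ_log_self (by norm_num) n)
  refine h1.trans ?_
  have h2 := sum_dyadic_le hsub hr
  have e : (K * NNReal.sqrt n * (9 * ∑ k ∈ Finset.Icc 1 n, a k / (k : ℝ≥0) ^ (3 / 2 : ℝ)) : ℝ≥0) =
      (((9 * K : ℝ≥0) : ℝ≥0∞) * (n : ℝ≥0∞) ^ (1 / 2 : ℝ) * ∑ k ∈ Finset.Icc 1 n,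
          eLpNorm (μ[∑ i ∈ Finset.range k, X i | 𝓖 0]) p μ / (k : ℝ≥0∞) ^ (3 / 2 : ℝ)) := by
    have e1 : ∀ k ∈ Finset.Icc 1 n, eLpNorm (μ[∑ i ∈ Finset.range k, X i | 𝓖 0]) p μ /
        (k : ℝ≥0∞) ^ (3 / 2 : ℝ) = ((a k / (k : ℝ≥0) ^ (3 / 2 : ℝ) : ℝ≥0) : ℝ≥0∞) := by
      intro k hk
      have hk0 : (k : ℝ≥0) ^ (3 / 2 : ℝ) ≠ 0 := by
        rw [Finset.mem_Icc] at hk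
        exact (NNReal.rpow_pos (by exact_mod_cast hk.1)).ne'
      rw [ENNReal.coe_div hk0, hac, ENNReal.coe_rpow_of_nonneg _ (by norm_num)]
      simp
    rw [Finset.sum_congr rfl e1, NNReal.sqrt_eq_rpow]
    push_cast
    rw [ENNReal.coe_rpow_of_nonneg _ (by norm_num)]
    push_cast
    ring
  rw [← e, ENNReal.coe_le_coe]
  gcongr

/-! ### Conditional expectations, shifts and commutation -/

lemma condExp_comp_measurePreserving {Ω : Type*} {m m' mΩ : MeasurableSpace Ω} {μ : Measure Ω}
    [IsProbabilityMeasure μ] {τ : Ω ≃ᵐ Ω} (hτ : MeasurePreserving τ μ μ) (hm : m ≤ mΩ)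
    (hm' : MeasurableSpace.comap τ m = m') {f : Ω → ℝ} (hf : Integrable f μ) :
    μ[f ∘ τ | m'] =ᵐ[μ] μ[f | m] ∘ τ := by
  subst hm'
  have hle : MeasurableSpace.comap τ m ≤ mΩ := by
    rintro _ ⟨t, ht, rfl⟩
    exact τ.measurable (hm t ht)
  have hτm : Measurable[MeasurableSpace.comap τ m, m] τ := comap_measurable τ
  refine (ae_eq_condExp_of_forall_setIntegral_eq hle (hτ.integrable_comp_of_integrable hf)
    (fun s _ _ => (hτ.integrable_comp_of_integrable integrable_condExp).integrableOn) ?_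
    (stronglyMeasurable_condExp.comp_measurable hτm).aestronglyMeasurable).symm
  rintro _ ⟨t, ht, rfl⟩ -
  simp only [Function.comp_apply]
  rw [hτ.setIntegral_preimage_emb τ.measurableEmbedding (fun ω => (μ[f | m]) ω),
    hτ.setIntegral_preimage_emb τ.measurableEmbedding f, setIntegral_condExp hm hf ht]

/-- Extends commutation from bounded to integrable functions: truncate at level `n` and pass to the
limit in `L¹` by dominated convergence. -/
lemma condExp_eq_condExp_of_forall_bounded {Ω : Type*} {m m₁ m₂ mΩ : MeasurableSpace Ω}
    {μ : Measure Ω} [IsProbabilityMeasure μ] (hm : m ≤ mΩ) (hm₁ : m₁ ≤ mΩ) (hm₂ : m₂ ≤ mΩ)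
    (h : ∀ Y : Ω → ℝ, Measurable[m] Y → (∃ B : ℝ, ∀ ω, |Y ω| ≤ B) → μ[Y | m₁] =ᵐ[μ] μ[Y | m₂])
    {f : Ω → ℝ} (hfm : AEStronglyMeasurable[m] f μ) (hf : Integrable f μ) :
    μ[f | m₁] =ᵐ[μ] μ[f | m₂] := by
  obtain ⟨g, hg, hfg⟩ := hfm
  have hgi : Integrable g μ := hf.congr hfg
  refine (condExp_congr_ae hfg).trans (Filter.EventuallyEq.trans ?_ (condExp_congr_ae hfg).symm)
  set Y : ℕ → Ω → ℝ := fun n ω => max (-(n : ℝ)) (min n (g ω)) with hY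
  have hYm : ∀ n, Measurable[m] (Y n) := fun n =>
    measurable_const.max (measurable_const.min hg.measurable)
  have hYn : ∀ n ω, |Y n ω| ≤ n := fun n ω => by
    have : (0 : ℝ) ≤ n := n.cast_nonneg
    rw [abs_le]
    exact ⟨le_max_left _ _, max_le (by linarith) (min_le_left _ _)⟩
  have hYg : ∀ n ω, |Y n ω| ≤ |g ω| := fun n ω => by
    have h0 : (0 : ℝ) ≤ n := n.cast_nonneg
    have h1 := neg_abs_le (g ω)
    have h2 := le_abs_self (g ω)
    have h3 := abs_nonneg (g ω)
    rw [abs_le]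
    refine ⟨?_, max_le (by linarith) ((min_le_right _ _).trans h2)⟩
    refine le_trans ?_ (le_max_right _ _)
    exact le_min (by linarith) h1
  have hlim : ∀ᵐ ω ∂μ, Filter.Tendsto (fun n => Y n ω) Filter.atTop (nhds (g ω)) := by
    refine Filter.Eventually.of_forall fun ω => ?_
    refine tendsto_const_nhds.congr' ?_
    obtain ⟨N, hN⟩ := exists_nat_ge |g ω|
    filter_upwards [Filter.eventually_ge_atTop N] with n hn
    have hn' : |g ω| ≤ n := hN.trans (by exact_mod_cast hn)
    rw [abs_le] at hn'
    simp only [hY]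
    rw [min_eq_right hn'.2, max_eq_right hn'.1]
  have hYs : ∀ n, AEStronglyMeasurable (Y n) μ := fun n =>
    ((hYm n).mono hm le_rfl).aestronglyMeasurable
  have hYb : ∀ n, ∀ᵐ ω ∂μ, ‖Y n ω‖ ≤ |g ω| := fun n => Filter.Eventually.of_forall (hYg n)
  have t₁ := tendsto_condExpL1_of_dominated_convergence hm₁ _ hYs hgi.abs hYb hlim
  have t₂ := tendsto_condExpL1_of_dominated_convergence hm₂ _ hYs hgi.abs hYb hlim
  have heq : ∀ n, condExpL1 hm₁ μ (Y n) = condExpL1 hm₂ μ (Y n) := fun n => by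
    refine Lp.ext ?_
    exact (condExp_ae_eq_condExpL1 hm₁ _).symm.trans
      ((h _ (hYm n) ⟨n, hYn n⟩).trans (condExp_ae_eq_condExpL1 hm₂ _))
  have := tendsto_nhds_unique t₁ (t₂.congr fun n => (heq n).symm)
  refine (condExp_ae_eq_condExpL1 hm₁ _).trans ?_
  rw [this]
  exact (condExp_ae_eq_condExpL1 hm₂ _).symm

section Group

variable {Ω : Type*} {mΩ : MeasurableSpace Ω} {μ : Measure Ω} {T : ℤ × ℤ → Ω ≃ᵐ Ω}
  {𝓕 : Filtration (ℤ × ℤ) mΩ}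

lemma IsMeasurePreservingGroup.memLp_comp (hT : IsMeasurePreservingGroup μ T) {g : Ω → ℝ}
    {p : ℝ≥0∞} (hg : MemLp g p μ) (k : ℤ × ℤ) : MemLp (g ∘ T k) p μ :=
  hg.comp_measurePreserving (hT.measurePreserving k)

lemma IsMeasurePreservingGroup.eLpNorm_comp (hT : IsMeasurePreservingGroup μ T) {g : Ω → ℝ}
    {p : ℝ≥0∞} (hg : AEStronglyMeasurable g μ) (k : ℤ × ℤ) :
    eLpNorm (g ∘ T k) p μ = eLpNorm g p μ :=
  eLpNorm_comp_measurePreserving hg (hT.measurePreserving k)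

lemma IsShifted.comap_eq (hF : IsShifted T 𝓕) (c v : ℤ × ℤ) :
    MeasurableSpace.comap (T v) (𝓕 c) = 𝓕 (c + v) :=
  hF v.1 v.2 c.1 c.2

lemma IsShifted.aestronglyMeasurable_comp (hF : IsShifted T 𝓕)
    (hT : IsMeasurePreservingGroup μ T) {c : ℤ × ℤ} {g : Ω → ℝ}
    (hg : AEStronglyMeasurable[𝓕 c] g μ) (v : ℤ × ℤ) :
    AEStronglyMeasurable[𝓕 (c + v)] (g ∘ T v) μ := by
  obtain ⟨g', hg', hgg⟩ := hg
  refine ⟨g' ∘ T v, ?_, (hT.measurePreserving v).quasiMeasurePreserving.ae_eq_comp hgg⟩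
  rw [← hF.comap_eq c v]
  exact hg'.comp_measurable (comap_measurable (T v))

lemma IsShifted.condExp_comp [IsProbabilityMeasure μ] (hF : IsShifted T 𝓕)
    (hT : IsMeasurePreservingGroup μ T) (c v : ℤ × ℤ) {g : Ω → ℝ} (hg : Integrable g μ) :
    μ[g ∘ T v | 𝓕 (c + v)] =ᵐ[μ] μ[g | 𝓕 c] ∘ T v :=
  condExp_comp_measurePreserving (hT.measurePreserving v) (𝓕.le c) (hF.comap_eq c v) hg

lemma IsCommuting.condExp_eq [IsProbabilityMeasure μ] (hC : IsCommuting μ 𝓕) (i j k l : ℤ)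
    {g : Ω → ℝ} (hgm : AEStronglyMeasurable[𝓕 (k, l)] g μ) (hg : Integrable g μ) :
    μ[g | 𝓕 (i, j)] =ᵐ[μ] μ[g | 𝓕 (min i k, min j l)] :=
  condExp_eq_condExp_of_forall_bounded (𝓕.le _) (𝓕.le _) (𝓕.le _)
    (fun Y hY hB => hC i j k l Y hY hB) hgm hg

/-- The one-parameter filtration `i ↦ 𝓕 (c + i • e)`. -/
def rayFiltration (𝓕 : Filtration (ℤ × ℤ) mΩ) (c : ℤ × ℤ) {e : ℤ × ℤ} (he : 0 ≤ e) :
    Filtration ℕ mΩ where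
  seq i := 𝓕 (c + i • e)
  mono' _ _ h := 𝓕.mono (add_le_add le_rfl (nsmul_le_nsmul_left he h))
  le' _ := 𝓕.le _

end Group

/-! ### One-parameter inequalities along rays of `ℤ²` -/

lemma eLpNorm_sum_ray_martingaleDiff_le {p : ℝ≥0∞} (hp : 2 ≤ p) (hp_top : p ≠ ∞) :
    ∃ K : ℝ≥0, ∀ {Ω : Type*} {mΩ : MeasurableSpace Ω} {μ : Measure Ω} [IsProbabilityMeasure μ]
      {T : ℤ × ℤ → Ω ≃ᵐ Ω} {𝓕 : Filtration (ℤ × ℤ) mΩ} (_ : IsMeasurePreservingGroup μ T)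
      (_ : IsShifted T 𝓕) {c e : ℤ × ℤ} (_ : 0 ≤ e) {g : Ω → ℝ} (_ : MemLp g p μ)
      (_ : AEStronglyMeasurable[𝓕 (c + e)] g μ) (_ : μ[g | 𝓕 c] =ᵐ[μ] 0) (n : ℕ),
      eLpNorm (∑ i ∈ Finset.range n, g ∘ T (i • e)) p μ ≤
        K * (n : ℝ≥0∞) ^ (1 / 2 : ℝ) * eLpNorm g p μ := by
  have hp1 : 1 ≤ p := le_trans (by norm_num) hp
  obtain ⟨K, hK⟩ := eLpNorm_sum_martingaleDiff_le hp hp_top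
  refine ⟨K, ?_⟩
  intro Ω mΩ μ _ T 𝓕 hT hF c e he g hg hgm hc n
  have hD : ((eLpNorm g p μ).toNNReal : ℝ≥0∞) = eLpNorm g p μ := ENNReal.coe_toNNReal hg.2.ne
  refine (hK (rayFiltration 𝓕 c he) (fun i => g ∘ T (i • e)) (fun i => ?_) (fun i => ?_)
    (eLpNorm g p μ).toNNReal (fun i => ?_) n).trans (le_of_eq ?_)
  · have h := hF.aestronglyMeasurable_comp hT hgm (i • e)
    rwa [show c + e + i • e = c + (i + 1) • e by rw [add_smul, one_smul]; abel] at h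
  · refine (hF.condExp_comp hT c (i • e) (hg.integrable hp1)).trans ?_
    exact (hT.measurePreserving _).quasiMeasurePreserving.ae_eq_comp hc
  · rw [hD, hT.eLpNorm_comp hg.1]
  · rw [NNReal.sqrt_eq_rpow]
    push_cast
    rw [hD, ENNReal.coe_rpow_of_nonneg _ (by norm_num)]
    push_cast
    ring

lemma eLpNorm_sum_ray_le {p : ℝ≥0∞} (hp : 2 ≤ p) (hp_top : p ≠ ∞) :
    ∃ K : ℝ≥0, ∀ {Ω : Type*} {mΩ : MeasurableSpace Ω} {μ : Measure Ω} [IsProbabilityMeasure μ]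
      {T : ℤ × ℤ → Ω ≃ᵐ Ω} {𝓕 : Filtration (ℤ × ℤ) mΩ} (_ : IsMeasurePreservingGroup μ T)
      (_ : IsShifted T 𝓕) {c e : ℤ × ℤ} (_ : 0 ≤ e) {g : Ω → ℝ} (_ : MemLp g p μ)
      (_ : AEStronglyMeasurable[𝓕 c] g μ) (n : ℕ),
      eLpNorm (∑ i ∈ Finset.range n, g ∘ T (i • e)) p μ ≤
        K * (n : ℝ≥0∞) ^ (1 / 2 : ℝ) * ∑ k ∈ Finset.Icc 1 n,
          eLpNorm (μ[∑ i ∈ Finset.range k, g ∘ T (i • e) | 𝓕 c]) p μ /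
            (k : ℝ≥0∞) ^ (3 / 2 : ℝ) := by
  have hp1 : 1 ≤ p := le_trans (by norm_num) hp
  obtain ⟨K, hK⟩ := eLpNorm_sum_le_of_stationary hp hp_top
  refine ⟨K, ?_⟩
  intro Ω mΩ μ _ T 𝓕 hT hF c e he g hg hgm n
  have h0 : rayFiltration 𝓕 c he 0 = 𝓕 c := by
    change 𝓕 (c + 0 • e) = 𝓕 c
    simp
  have h := hK (rayFiltration 𝓕 c he) (fun i => g ∘ T (i • e)) (fun i => hT.memLp_comp hg _)
    (fun i => hF.aestronglyMeasurable_comp hT hgm (i • e)) (fun s k => ?_) n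
  · rwa [h0] at h
  · rw [h0]
    -- A block starting at `s` is the initial block shifted by `T (s • e)`. The shift moves `𝓕 c` to
    -- `𝓕 (c + s • e)` and preserves norms, which is the required stationarity.
    have e1 : ∑ i ∈ Finset.Ico s (s + k), g ∘ T (i • e) =
        (∑ i ∈ Finset.range k, g ∘ T (i • e)) ∘ T (s • e) := by
      rw [Finset.sum_Ico_eq_sum_range, Nat.add_sub_cancel_left]
      funext ω
      simp only [Finset.sum_apply, Function.comp_apply]
      refine Finset.sum_congr rfl fun i _ => ?_
      rw [← hT.map_add, ← add_smul, add_comm]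
    have hS : MemLp (∑ i ∈ Finset.range k, g ∘ T (i • e)) p μ :=
      memLp_finsetSum' _ fun i _ => hT.memLp_comp hg _
    rw [e1]
    change eLpNorm (μ[_ | 𝓕 (c + s • e)]) p μ = _
    rw [eLpNorm_congr_ae (hF.condExp_comp hT c (s • e) (hS.integrable hp1)),
      hT.eLpNorm_comp (hS.condExp hp1).1]

/-! ### Sums over rectangles -/

section PartialSum

variable {Ω : Type*} {mΩ : MeasurableSpace Ω} {μ : Measure Ω} {T : ℤ × ℤ → Ω ≃ᵐ Ω}

lemma sum_Icc_one_eq_sum_range {M : Type*} [AddCommMonoid M] (φ : ℕ → M) (n : ℕ) :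
    ∑ i ∈ Finset.Icc 1 n, φ i = ∑ i ∈ Finset.range n, φ (i + 1) := by
  rw [Finset.range_eq_Ico, Finset.sum_Ico_add' φ 0 n 1]
  rfl

lemma partialSum_eq_sum_columns (hT : IsMeasurePreservingGroup μ T) (f : Ω → ℝ) (m n : ℕ) :
    partialSum T f m n = ∑ i ∈ Finset.range m,
      (∑ j ∈ Finset.range n, (f ∘ T (1, 1)) ∘ T (j • (0, 1))) ∘ T (i • (1, 0)) := by
  funext ω
  simp only [partialSum, Finset.sum_apply, Function.comp_apply, sum_Icc_one_eq_sum_range]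
  refine Finset.sum_congr rfl fun i _ => Finset.sum_congr rfl fun j _ => ?_
  rw [← hT.map_add, ← hT.map_add]
  congr 3
  ext <;> simp [add_comm]

lemma partialSum_eq_sum_rows (hT : IsMeasurePreservingGroup μ T) (f : Ω → ℝ) (m n : ℕ) :
    partialSum T f m n = ∑ j ∈ Finset.range n,
      (∑ i ∈ Finset.range m, (f ∘ T (1, 1)) ∘ T (i • (1, 0))) ∘ T (j • (0, 1)) := by
  funext ω
  simp only [partialSum, Finset.sum_apply, Function.comp_apply, sum_Icc_one_eq_sum_range]
  rw [Finset.sum_comm]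
  refine Finset.sum_congr rfl fun j _ => Finset.sum_congr rfl fun i _ => ?_
  rw [← hT.map_add, ← hT.map_add]
  congr 3
  ext <;> simp [add_comm]

/-- By commutation, conditioning a partial sum on `𝓕 (1, n)` conditions each of its rows on the
past of the first column. -/
lemma condExp_partialSum_eq [IsProbabilityMeasure μ] {𝓕 : Filtration (ℤ × ℤ) mΩ}
    (hT : IsMeasurePreservingGroup μ T) (hF : IsShifted T 𝓕) (hC : IsCommuting μ 𝓕) {f : Ω → ℝ}
    (hf : Integrable f μ) (hfm : AEStronglyMeasurable[𝓕 (0, 0)] f μ) {k : ℕ} (hk : 1 ≤ k)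
    (n : ℕ) :
    μ[partialSum T f k n | 𝓕 (1, (n : ℤ))] =ᵐ[μ] ∑ j ∈ Finset.range n,
      μ[∑ i ∈ Finset.range k, (f ∘ T (1, 1)) ∘ T (i • (1, 0)) | 𝓕 (1, 1)] ∘ T (j • (0, 1)) := by
  have hi : ∀ {g : Ω → ℝ}, Integrable g μ → ∀ v, Integrable (g ∘ T v) μ := fun hg v =>
    (hT.measurePreserving v).integrable_comp_of_integrable hg
  set R := ∑ i ∈ Finset.range k, (f ∘ T (1, 1)) ∘ T (i • (1, 0))
  have hRi : Integrable R μ := integrable_finsetSum' _ fun i _ => hi (hi hf _) _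
  have hRm : AEStronglyMeasurable[𝓕 ((k : ℤ), 1)] R μ :=
    aestronglyMeasurable_finsetSum fun i hik =>
      (hF.aestronglyMeasurable_comp hT (hF.aestronglyMeasurable_comp hT hfm _) _).mono
        (𝓕.mono (by
          rw [Finset.mem_range] at hik
          simp only [Prod.smul_mk, Prod.mk_add_mk, Prod.mk_le_mk]
          constructor <;> simp; omega))
  rw [partialSum_eq_sum_rows hT]
  refine (condExp_finsetSum (fun j _ => hi hRi _) _).trans (eventuallyEq_sum fun j hj => ?_)
  rw [Finset.mem_range] at hj
  have hm := hF.aestronglyMeasurable_comp hT hRm (j • (0, 1))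
  have ha : ((k : ℤ), (1 : ℤ)) + j • ((0 : ℤ), (1 : ℤ)) = ((k : ℤ), 1 + (j : ℤ)) := by
    ext <;> simp
  rw [ha] at hm
  refine (hC.condExp_eq 1 n k (1 + j) hm (hi hRi _)).trans ?_
  -- Here `1 ≤ k` and `j < n` enter: row `j` is conditioned on `𝓕 (1, 1 + j)`, the shift of `𝓕 (1,
  -- 1)`, independently of `n`.
  have hmin : (min (1 : ℤ) k, min (n : ℤ) (1 + j)) =
      ((1 : ℤ), (1 : ℤ)) + j • ((0 : ℤ), (1 : ℤ)) := by
    ext <;> simp <;> omega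
  rw [hmin]
  exact hF.condExp_comp hT _ _ hRi

end PartialSum

lemma eLpNorm_partialSum_le {p : ℝ≥0∞} (hp : 2 ≤ p) (hp_top : p ≠ ∞) :
    ∃ C : ℝ≥0, ∀ {Ω : Type*} {mΩ : MeasurableSpace Ω} {μ : Measure Ω} [IsProbabilityMeasure μ]
      {T : ℤ × ℤ → Ω ≃ᵐ Ω} {𝓕 : Filtration (ℤ × ℤ) mΩ} (_ : IsMeasurePreservingGroup μ T)
      (_ : IsShifted T 𝓕) (_ : IsCommuting μ 𝓕) {f : Ω → ℝ} (_ : MemLp f p μ)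
      (_ : AEStronglyMeasurable[𝓕 (0, 0)] f μ) (m n : ℕ),
      eLpNorm (partialSum T f m n) p μ ≤
        C * (m : ℝ≥0∞) ^ (1 / 2 : ℝ) * (n : ℝ≥0∞) ^ (1 / 2 : ℝ) *
          ∑ k ∈ Finset.Icc 1 m, ∑ l ∈ Finset.Icc 1 n,
            eLpNorm (μ[partialSum T f k l | 𝓕 (1, 1)]) p μ /
              ((k : ℝ≥0∞) ^ (3 / 2 : ℝ) * (l : ℝ≥0∞) ^ (3 / 2 : ℝ)) := by
  have hp1 : 1 ≤ p := le_trans (by norm_num) hp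
  obtain ⟨K, hK⟩ := eLpNorm_sum_ray_le hp hp_top
  refine ⟨K * K, ?_⟩
  intro Ω mΩ μ _ T 𝓕 hT hF hC f hf hfm m n
  have hfi := hf.integrable hp1
  have hg : MemLp (f ∘ T (1, 1)) p μ := hT.memLp_comp hf _
  have hgm : AEStronglyMeasurable[𝓕 (1, 1)] (f ∘ T (1, 1)) μ := by
    simpa using hF.aestronglyMeasurable_comp hT hfm (1, 1)
  -- First use, across columns: the first column, of height `n`, is `𝓕 (1, n)`-measurable.
  have h1 := hK hT hF (c := (1, (n : ℤ))) (e := (1, 0)) (by constructor <;> simp)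
    (g := ∑ j ∈ Finset.range n, (f ∘ T (1, 1)) ∘ T (j • (0, 1)))
    (memLp_finsetSum' _ fun j _ => hT.memLp_comp hg _)
    (aestronglyMeasurable_finsetSum fun j hj =>
      (hF.aestronglyMeasurable_comp hT hgm _).mono (𝓕.mono (by
        rw [Finset.mem_range] at hj
        simp only [Prod.smul_mk, Prod.mk_add_mk, Prod.mk_le_mk]
        constructor <;> simp; omega))) m
  simp only [← partialSum_eq_sum_columns hT] at h1
  have h2 : ∀ k ∈ Finset.Icc 1 m, eLpNorm (μ[partialSum T f k n | 𝓕 (1, (n : ℤ))]) p μ ≤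
      K * (n : ℝ≥0∞) ^ (1 / 2 : ℝ) * ∑ l ∈ Finset.Icc 1 n,
        eLpNorm (μ[partialSum T f k l | 𝓕 (1, 1)]) p μ / (l : ℝ≥0∞) ^ (3 / 2 : ℝ) := by
    intro k hk
    rw [Finset.mem_Icc] at hk
    rw [eLpNorm_congr_ae (condExp_partialSum_eq hT hF hC hfi hfm hk.1 n)]
    have hR : MemLp (∑ i ∈ Finset.range k, (f ∘ T (1, 1)) ∘ T (i • (1, 0))) p μ :=
      memLp_finsetSum' _ fun i _ => hT.memLp_comp hg _
    -- Second use, along the column direction, with the row sum conditioned on `𝓕 (1, 1)` as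
    -- generating function.
    refine (hK hT hF (c := (1, 1)) (e := (0, 1)) (by constructor <;> simp) (hR.condExp hp1)
      stronglyMeasurable_condExp.aestronglyMeasurable n).trans (le_of_eq ?_)
    congr 1
    refine Finset.sum_congr rfl fun l hl => ?_
    rw [Finset.mem_Icc] at hl
    congr 1
    refine eLpNorm_congr_ae ?_
    -- Read backwards for height `l`, commutation recovers `E(S_{k,l} | 𝓕 (1, l))`, and the tower
    -- property reduces it to `𝓕 (1, 1)`.
    refine (condExp_congr_ae (condExp_partialSum_eq hT hF hC hfi hfm hk.1 l).symm).trans ?_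
    refine condExp_condExp_of_le (𝓕.mono ?_) (𝓕.le _)
    exact ⟨le_rfl, by simpa using hl.1⟩
  refine h1.trans ?_
  have h3 : ∑ k ∈ Finset.Icc 1 m, eLpNorm (μ[partialSum T f k n | 𝓕 (1, (n : ℤ))]) p μ /
      (k : ℝ≥0∞) ^ (3 / 2 : ℝ) ≤ K * (n : ℝ≥0∞) ^ (1 / 2 : ℝ) *
        ∑ k ∈ Finset.Icc 1 m, ∑ l ∈ Finset.Icc 1 n,
          eLpNorm (μ[partialSum T f k l | 𝓕 (1, 1)]) p μ /
            ((k : ℝ≥0∞) ^ (3 / 2 : ℝ) * (l : ℝ≥0∞) ^ (3 / 2 : ℝ)) := by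
    rw [Finset.mul_sum]
    refine Finset.sum_le_sum fun k hk => ?_
    refine (ENNReal.div_le_div_right (h2 k hk) _).trans (le_of_eq ?_)
    rw [Finset.mem_Icc] at hk
    have hk0 : (k : ℝ≥0∞) ^ (3 / 2 : ℝ) ≠ 0 := by
      rw [Ne, ENNReal.rpow_eq_zero_iff_of_pos (by norm_num)]
      simp; omega
    have hkt : (k : ℝ≥0∞) ^ (3 / 2 : ℝ) ≠ ∞ :=
      ENNReal.rpow_ne_top_of_nonneg (by norm_num) (by simp)
    rw [mul_div_assoc, ENNReal.div_eq_inv_mul, Finset.mul_sum]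
    congr 1
    refine Finset.sum_congr rfl fun l _ => ?_
    generalize (k : ℝ≥0∞) ^ (3 / 2 : ℝ) = x at hk0 hkt ⊢
    generalize (l : ℝ≥0∞) ^ (3 / 2 : ℝ) = y
    rw [div_eq_mul_inv, div_eq_mul_inv, ENNReal.mul_inv (Or.inl hk0) (Or.inl hkt)]
    ring
  refine (mul_le_mul_right h3 _).trans (le_of_eq ?_)
  push_cast
  ring

/-- Within a column, `E(f | 𝓕 (0, -1)) = 0` gives martingale differences. Commutation and `E(f | 𝓕
(-1, 0)) = 0` make whole columns martingale differences in the other direction. -/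
lemma eLpNorm_partialSum_martingaleDiff_le {p : ℝ≥0∞} (hp : 2 ≤ p) (hp_top : p ≠ ∞) :
    ∃ C : ℝ≥0, ∀ {Ω : Type*} {mΩ : MeasurableSpace Ω} {μ : Measure Ω} [IsProbabilityMeasure μ]
      {T : ℤ × ℤ → Ω ≃ᵐ Ω} {𝓕 : Filtration (ℤ × ℤ) mΩ} (_ : IsMeasurePreservingGroup μ T)
      (_ : IsShifted T 𝓕) (_ : IsCommuting μ 𝓕) {f : Ω → ℝ}
      (_ : IsMartingaleDifference μ 𝓕 f p) (m n : ℕ),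
      eLpNorm (partialSum T f m n) p μ ≤
        C * (m : ℝ≥0∞) ^ (1 / 2 : ℝ) * (n : ℝ≥0∞) ^ (1 / 2 : ℝ) * eLpNorm f p μ := by
  have hp1 : 1 ≤ p := le_trans (by norm_num) hp
  obtain ⟨K, hK⟩ := eLpNorm_sum_ray_martingaleDiff_le hp hp_top
  refine ⟨K * K, ?_⟩
  intro Ω mΩ μ _ T 𝓕 hT hF hC f hd m n
  obtain ⟨⟨hfm, hf⟩, hfst, hsnd⟩ := hd
  have hfi := hf.integrable hp1
  have hg : MemLp (f ∘ T (1, 1)) p μ := hT.memLp_comp hf _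
  have hgi := hg.integrable hp1
  have hgm : AEStronglyMeasurable[𝓕 (1, 1)] (f ∘ T (1, 1)) μ := by
    simpa using hF.aestronglyMeasurable_comp hT hfm (1, 1)
  have hzero : ∀ {g : Ω → ℝ} {c : ℤ × ℤ}, Integrable g μ → μ[g | 𝓕 c] =ᵐ[μ] 0 → ∀ v,
      μ[g ∘ T v | 𝓕 (c + v)] =ᵐ[μ] 0 := fun hgi hg0 v =>
    (hF.condExp_comp hT _ v hgi).trans
      ((hT.measurePreserving v).quasiMeasurePreserving.ae_eq_comp hg0)
  have h1 : eLpNorm (∑ j ∈ Finset.range n, (f ∘ T (1, 1)) ∘ T (j • (0, 1))) p μ ≤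
      K * (n : ℝ≥0∞) ^ (1 / 2 : ℝ) * eLpNorm f p μ := by
    rw [← hT.eLpNorm_comp hf.1 (1, 1)]
    refine hK hT hF (c := (1, 0)) (e := (0, 1)) (by constructor <;> simp) hg (by simpa using hgm)
      ?_ n
    simpa using hzero hfi hfst (1, 1)
  have h2 := hK hT hF (c := (0, (n : ℤ))) (e := (1, 0)) (by constructor <;> simp)
    (g := ∑ j ∈ Finset.range n, (f ∘ T (1, 1)) ∘ T (j • (0, 1)))
    (memLp_finsetSum' _ fun j _ => hT.memLp_comp hg _)
    (aestronglyMeasurable_finsetSum fun j hj =>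
      (hF.aestronglyMeasurable_comp hT hgm _).mono (𝓕.mono (by
        rw [Finset.mem_range] at hj
        simp only [Prod.smul_mk, Prod.mk_add_mk, Prod.mk_le_mk]
        constructor <;> simp; omega))) (by
      refine (condExp_finsetSum (fun j _ => (hT.memLp_comp hg _).integrable hp1) _).trans ?_
      refine (eventuallyEq_sum (g := fun _ => 0) fun j hj => ?_).trans (by simp)
      rw [Finset.mem_range] at hj
      have hm := hF.aestronglyMeasurable_comp hT hgm (j • (0, 1))
      have ha : ((1 : ℤ), (1 : ℤ)) + j • ((0 : ℤ), (1 : ℤ)) = (1, 1 + (j : ℤ)) := by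
        ext <;> simp
      rw [ha] at hm
      refine (hC.condExp_eq 0 n 1 (1 + j) hm ((hT.memLp_comp hg _).integrable hp1)).trans ?_
      -- Commutation lowers `𝓕 (0, n)` to `𝓕 (0, 1 + j)`, which is `𝓕 (-1, 0)` shifted by the index
      -- `(1, 1 + j)` of the summand.
      have hmin : (min (0 : ℤ) 1, min (n : ℤ) (1 + j)) =
          ((-1 : ℤ), (0 : ℤ)) + (1, 1) + j • ((0 : ℤ), (1 : ℤ)) := by
        ext <;> (simp; try omega)
      rw [hmin]
      exact hzero hgi (hzero hfi hsnd (1, 1)) (j • (0, 1))) m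
  rw [← partialSum_eq_sum_columns hT] at h2
  refine (h2.trans (mul_le_mul_right h1 _)).trans (le_of_eq ?_)
  push_cast
  ring

end RandomField

/-- The constant depends only on `p`; all norms are `ℝ≥0∞`-valued, so the bounds contain the
assertion that the left-hand sides are finite. -/
theorem mainTheorem7 (p : ℝ≥0∞) (hp : 2 ≤ p) (hp_top : p ≠ ∞) :
    ∃ C : ℝ≥0, ∀ (Ω : Type*) (mΩ : MeasurableSpace Ω) (μ : Measure Ω) [IsProbabilityMeasure μ]
      (T : ℤ × ℤ → Ω ≃ᵐ Ω) (𝓕 : Filtration (ℤ × ℤ) mΩ),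
      RandomField.IsMeasurePreservingGroup μ T →
      RandomField.IsShifted T 𝓕 →
      RandomField.IsCommuting μ 𝓕 →
      ∀ f : Ω → ℝ,
        RandomField.MemLpSub μ (RandomField.sigmaTop 𝓕) f p →
        μ[f | RandomField.tailFst 𝓕] =ᵐ[μ] 0 →
        μ[f | RandomField.tailSnd 𝓕] =ᵐ[μ] 0 →
        (AEStronglyMeasurable[𝓕 (0, 0)] f μ →
          ∀ m n : ℕ,
            eLpNorm (RandomField.partialSum T f m n) p μ ≤
              C * (m : ℝ≥0∞) ^ (1 / 2 : ℝ) * (n : ℝ≥0∞) ^ (1 / 2 : ℝ) *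
                ∑ k ∈ Finset.Icc 1 m, ∑ l ∈ Finset.Icc 1 n,
                  eLpNorm (μ[RandomField.partialSum T f k l | 𝓕 (1, 1)]) p μ /
                    ((k : ℝ≥0∞) ^ (3 / 2 : ℝ) * (l : ℝ≥0∞) ^ (3 / 2 : ℝ))) ∧
        (RandomField.IsMartingaleDifference μ 𝓕 f p →
          ∀ m n : ℕ,
            eLpNorm (RandomField.partialSum T f m n) p μ ≤
              C * (m : ℝ≥0∞) ^ (1 / 2 : ℝ) * (n : ℝ≥0∞) ^ (1 / 2 : ℝ) * eLpNorm f p μ) := by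
  obtain ⟨C₁, h₁⟩ := RandomField.eLpNorm_partialSum_le hp hp_top
  obtain ⟨C₂, h₂⟩ := RandomField.eLpNorm_partialSum_martingaleDiff_le hp hp_top
  refine ⟨max C₁ C₂, ?_⟩
  intro Ω mΩ μ _ T 𝓕 hT hF hC f hf _ _
  refine ⟨fun hfm m n => (h₁ hT hF hC hf.2 hfm m n).trans ?_,
    fun hd m n => (h₂ hT hF hC hd m n).trans ?_⟩
  · gcongr
    exact le_max_left _ _
  · gcongr
    exact le_max_right _ _
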